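/- A word $w=w_1\cdots w_n$ of natural numbers *contains* a pattern $p=p_1\cdots p_k$ if there are indices $i_1<\cdots<i_k$ such that $w_{i_1}\cdots w_{i_k}$ is order isomorphic to $p$ (that is, $w_{i_a}<w_{i_b}$ if and only if $p_a<p_b$, for all $a,b$); otherwise $w$ *avoids* $p$. Let $\mathfrak{S}_n(P)$ be the set of permutations of $\{1,\dots,n\}$ (in one-line notation) that avoid every pattern in $P$, and let $\mathbf{I}_n(P)$ be the set of inversion sequences $(e_1,\dots,e_n)\in\mathbb{N}^n$, $0\le e_i<i$, that avoid every pattern in $P$. Let $a_n$ be the sequence A212198 of the OEIS ($1,2,6,24,116,632,3720,\dots$ for $n=1,2,3,\dots$), the number of permutations of $\{1,\dots,n\}$ that avoid the quadrant marked mesh pattern $\mathrm{MMP}(0,2,0,2)$, i.e. in which no letter has at least two larger letters to its left and at least two smaller letters to its right. Then for every $n\ge 0$ each of the following five classes has exactly $a_n$ elements: $$\mathfrak{S}_n(45312,45321,54312,54321),$$ $$\mathfrak{S}_n(31245,32145,31254,32154),$$ $$\mathfrak{S}_n(31425,32415,31524,32514),$$ $$\mathbf{I}_n(201,210),$$ $$\mathfrak{S}_n(41325,51324,42315,52314).$$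 -/

import Mathlib

/-- The word `w` contains the pattern `p`: some subsequence of `w` is order isomorphic to `p`.
Both words may have repeated letters; equal letters of `p` correspond to equal letters of the
subsequence, because `<` is reflected in both directions. -/
def ContainsPattern {n k : ℕ} (w : Fin n → ℕ) (p : Fin k → ℕ) : Prop :=
  ∃ f : Fin k → Fin n, StrictMono f ∧ ∀ i j, w (f i) < w (f j) ↔ p i < p j

/-- The word `w` avoids every pattern of the set `P`. -/
def AvoidsPatterns {n k : ℕ} (w : Fin n → ℕ) (P : Set (Fin k → ℕ)) : Prop :=
  ∀ p ∈ P, ¬ ContainsPattern w p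

/-- The one-line notation `π₁ π₂ ⋯ πₙ` of a permutation, with letters `1, …, n`. -/
def permWord {n : ℕ} (π : Equiv.Perm (Fin n)) : Fin n → ℕ :=
  fun i => (π i : ℕ) + 1

/-- `𝔖ₙ(P)`: the permutations of length `n` that avoid all patterns in `P`. -/
def permAvoiding (n : ℕ) {k : ℕ} (P : Set (Fin k → ℕ)) : Set (Equiv.Perm (Fin n)) :=
  {π | AvoidsPatterns (permWord π) P}

/-- `𝐈ₙ`: the inversion sequences `(e₁, …, eₙ)` of length `n`, that is `0 ≤ eᵢ < i` for
`1 ≤ i ≤ n`; the index `i : Fin n` stands for the position `i + 1`. -/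
def inversionSequences (n : ℕ) : Set (Fin n → ℕ) :=
  {e | ∀ i : Fin n, e i < (i : ℕ) + 1}

/-- `𝐈ₙ(P)`: the inversion sequences of length `n` that avoid all patterns in `P`. -/
def inversionSequencesAvoiding (n : ℕ) {k : ℕ} (P : Set (Fin k → ℕ)) : Set (Fin n → ℕ) :=
  {e | e ∈ inversionSequences n ∧ AvoidsPatterns e P}

/-- The position `i` of `π` matches the quadrant marked mesh pattern `MMP(a, b, c, d)`: in the
coordinate system centred at the point `(i, πᵢ)`, the graph of `π` has at least `a`, `b`, `c`
and `d` points in the quadrants I (upper right), II (upper left), III (lower left) and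
IV (lower right), respectively. -/
def MatchesMMP (a b c d : ℕ) {n : ℕ} (π : Equiv.Perm (Fin n)) (i : Fin n) : Prop :=
  a ≤ {j : Fin n | i < j ∧ π i < π j}.ncard ∧
  b ≤ {j : Fin n | j < i ∧ π i < π j}.ncard ∧
  c ≤ {j : Fin n | j < i ∧ π j < π i}.ncard ∧
  d ≤ {j : Fin n | i < j ∧ π j < π i}.ncard

/-- The sequence A212198 of the OEIS, `1, 2, 6, 24, 116, 632, 3720, …` for `n = 1, 2, 3, …`:
the number of permutations of length `n` that avoid the quadrant marked mesh pattern
`MMP(0, 2, 0, 2)`. -/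
noncomputable def A212198 (n : ℕ) : ℕ :=
  {π : Equiv.Perm (Fin n) | ∀ i, ¬ MatchesMMP 0 2 0 2 π i}.ncard

/-! Each class grows one letter at a time: a permutation by inserting a new maximum into a gap, an
inversion sequence by appending a letter. Deleting that letter never leaves the class, so the
members of size `n` are the nodes on level `n` of a generating tree (`ncard_good_eq_descendants`),
and the trees have to be shown equinumerous level by level.

In each set of four patterns a middle letter, two smaller and two larger letters have prescribed
places, and the order inside each pair is free. Avoidance thus forbids one relation `R` between
positions; for the first set this is the condition `MMP(0, 2, 0, 2)`. A gap is active if a maximum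
may enter it, and two gaps conflict if they cannot both be used. Inserting at `p` kills the gaps
that conflict with `p`, and the new maximum creates conflicts as a middle letter for later maxima.
In each class two numbers describe the resulting shape.

Write T_m(h) for `treeCount m h`. Inversion sequences and the class of `MidLowHighLowHigh` follow
the rule (h, k) → (i + 1, h - i + k) for 0 ≤ i ≤ h, with k further children having T_m(h + 2)
descendants each. The solution `treeCount₂` is affine in k, and the labels (h, 1) and (h + 1, 0)
count alike. The classes of `HighHighMidLowLow` and `MidLowLowHighHigh` obey a different rule whose
totals agree because of this affinity (`treeCount₂_succ_succ`). The class of `HighLowMidLowHigh` has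
a symmetric rule on pairs (a, b), solved by T_m(a + 1) + T_m(b + 1) - T_m(1). Every root yields
T_n(0). -/

/-! ### Counting by generating trees -/

section GeneratingTree

variable {X : ℕ → Type*} (ins : ∀ {n}, X n → Fin (n + 1) → X (n + 1))
  (Good : ∀ {n}, X n → Prop)

open Classical in
/-- The number of descendants, `m` generations below `x`, in the generating tree whose nodes are
the good objects and in which the children of `x` are the objects `ins x p`. -/
noncomputable def descendants : ℕ → ∀ {n : ℕ}, X n → ℤ
  | 0, _, _ => 1
  | m + 1, n, x => ∑ p : Fin (n + 1), if Good (ins x p) then descendants m (ins x p) else 0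

open Classical in
theorem ncard_good_eq_descendants [∀ n, Fintype (X n)]
    (hins : ∀ n, Function.Bijective fun y : X n × Fin (n + 1) => ins y.1 y.2)
    (hgood : ∀ {n} (x : X n) (p : Fin (n + 1)), Good (ins x p) → Good x)
    [Unique (X 0)] (h0 : Good (default : X 0)) (n : ℕ) :
    ({x : X n | Good x}.ncard : ℤ) = descendants ins Good n (default : X 0) := by
  -- One generation of descendants is traded for one unit of length; bad parents contribute nothing
  -- because all their children are bad.
  have step : ∀ n m : ℕ, (∑ x : X n, if Good x then descendants ins Good (m + 1) x else 0)
      = ∑ x : X (n + 1), if Good x then descendants ins Good m x else 0 := by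
    intro n m
    rw [← (Equiv.ofBijective _ (hins n)).sum_comp, Fintype.sum_prod_type]
    refine Finset.sum_congr rfl fun x _ => ?_
    by_cases hx : Good x
    · simp [hx, descendants]
    · have : ∀ p, ¬ Good (ins x p) := fun p hp => hx (hgood x p hp)
      simp [hx, this]
  have all : ∀ m n : ℕ, (∑ x : X n, if Good x then descendants ins Good m x else 0)
      = ∑ x : X (n + m), if Good x then descendants ins Good 0 x else 0 := by
    intro m
    induction m with
    | zero => intro n; rfl
    | succ m ih =>
      intro n
      rw [step, ih]
      have e : n + 1 + m = n + (m + 1) := by omega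
      rw [e]
  have h := all n 0
  rw [zero_add] at h
  rw [Set.ncard_eq_toFinset_card']
  simp only [descendants] at h
  simpa [h0] using h.symm

end GeneratingTree

/-! ### The counting functions -/

/-- The number of nodes `m` generations below a node with label `(h, 0)`. -/
def treeCount : ℕ → ℕ → ℤ
  | 0, _ => 1
  | m + 1, h => 2 * ∑ j ∈ Finset.range (h + 1), treeCount m (j + 1) - (h + 1) * treeCount m 1

/-- The number of nodes `m` generations below a node with label `(h, k)`. -/
def treeCount₂ (m h k : ℕ) : ℤ :=
  treeCount m h + k * (treeCount m (h + 1) - treeCount m h)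

theorem treeCount_succ_zero (m : ℕ) : treeCount (m + 1) 0 = treeCount m 1 := by
  simp [treeCount]; ring

theorem treeCount_succ_succ (m h : ℕ) :
    treeCount (m + 1) (h + 1)
      = treeCount (m + 1) h + 2 * treeCount m (h + 2) - treeCount m 1 := by
  simp only [treeCount]
  rw [Finset.sum_range_succ _ (h + 1)]
  push_cast
  ring

theorem treeCount₂_zero_right (m h : ℕ) : treeCount₂ m h 0 = treeCount m h := by
  simp [treeCount₂]

theorem treeCount₂_one_right (m h : ℕ) : treeCount₂ m h 1 = treeCount m (h + 1) := by
  simp [treeCount₂]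

theorem treeCount₂_zero (h k : ℕ) : treeCount₂ 0 h k = 1 := by
  simp [treeCount₂, treeCount]

/-- Raising `h` by one raises `k` by one in all the old terms, hence an induction on `h` for all `k`
at once. The coefficient of `k` is a telescoping sum. -/
theorem sum_treeCount₂ (m h k : ℕ) :
    ∑ i ∈ Finset.range (h + 1), treeCount₂ m (i + 1) (h - i + k)
      = treeCount (m + 1) h + k * (treeCount m (h + 2) - treeCount m 1) := by
  induction h generalizing k with
  | zero => simp [treeCount₂, treeCount]; ring
  | succ h ih =>
    rw [Finset.sum_range_succ]
    have e : ∑ i ∈ Finset.range (h + 1), treeCount₂ m (i + 1) (h + 1 - i + k)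
        = ∑ i ∈ Finset.range (h + 1), treeCount₂ m (i + 1) (h - i + (k + 1)) := by
      refine Finset.sum_congr rfl fun i hi => ?_
      have := Finset.mem_range.1 hi
      congr 1; omega
    rw [e, ih, treeCount_succ_succ]
    simp only [treeCount₂]
    push_cast [Nat.sub_self]
    ring

/-- The first succession rule. It matches the affine formula because the slope T_{m+1}(h+1) -
T_{m+1}(h) equals 2 T_m(h+2) - T_m(1). -/
theorem treeCount₂_succ (m h k : ℕ) :
    treeCount₂ (m + 1) h k
      = ∑ i ∈ Finset.range (h + 1), treeCount₂ m (i + 1) (h - i + k)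
        + k * treeCount m (h + 2) := by
  rw [sum_treeCount₂, treeCount₂, treeCount_succ_succ]
  ring

/-- The number of nodes `m` generations below a node with label `(a, b)` in the symmetric
tree. -/
def symmTreeCount (m a b : ℕ) : ℤ :=
  treeCount m (a + 1) + treeCount m (b + 1) - treeCount m 1

theorem symmTreeCount_comm (m a b : ℕ) : symmTreeCount m a b = symmTreeCount m b a := by
  simp only [symmTreeCount]; ring

/-- The two components run through T_m(1), …, T_m(a) and T_m(3), …, T_m(a+2); up to boundary terms
this is the doubled sum defining T_{m+1}(a+1). -/
theorem sum_symmTreeCount (m a : ℕ) :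
    ∑ i ∈ Finset.range a, symmTreeCount m i (a + 1 - i)
      = treeCount (m + 1) (a + 1) - treeCount m (a + 1) - treeCount m (a + 2)
        + treeCount m 1 - treeCount m 2 := by
  have h1 : ∑ i ∈ Finset.range a, treeCount m (a + 1 - i + 1)
      = ∑ i ∈ Finset.range a, treeCount m (i + 3) := by
    rw [← Finset.sum_range_reflect (fun i => treeCount m (i + 3))]
    refine Finset.sum_congr rfl fun i hi => ?_
    have := Finset.mem_range.1 hi
    congr 1; omega
  have h2 : ∑ i ∈ Finset.range (a + 2), treeCount m (i + 1)
      = ∑ i ∈ Finset.range a, treeCount m (i + 3) + treeCount m 2 + treeCount m 1 := by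
    rw [Finset.sum_range_succ', Finset.sum_range_succ']
  have h3 : ∑ i ∈ Finset.range (a + 2), treeCount m (i + 1)
      = ∑ i ∈ Finset.range a, treeCount m (i + 1) + treeCount m (a + 1)
        + treeCount m (a + 2) := by
    rw [Finset.sum_range_succ, Finset.sum_range_succ]
  simp only [symmTreeCount, Finset.sum_sub_distrib, Finset.sum_add_distrib, h1, treeCount,
    Finset.sum_const, Finset.card_range, nsmul_eq_mul]
  push_cast
  linarith

/-- The last sum, read backwards with components swapped, is the first one with `b` in place of `a`.
-/
theorem symmTreeCount_succ (m a b : ℕ) :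
    symmTreeCount (m + 1) a b
      = ∑ i ∈ Finset.range a, symmTreeCount m i (a + 1 - i) + symmTreeCount m a (b + 1)
        + (symmTreeCount m (a + 1) b
          + ∑ i ∈ Finset.range b, symmTreeCount m (i + 2) (b - 1 - i)) := by
  have h : ∑ i ∈ Finset.range b, symmTreeCount m (i + 2) (b - 1 - i)
      = ∑ i ∈ Finset.range b, symmTreeCount m i (b + 1 - i) := by
    rw [← Finset.sum_range_reflect (fun i => symmTreeCount m i (b + 1 - i))]
    refine Finset.sum_congr rfl fun i hi => ?_
    have := Finset.mem_range.1 hi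
    rw [symmTreeCount_comm]
    congr 1; omega
  rw [h, sum_symmTreeCount, sum_symmTreeCount]
  simp only [symmTreeCount]
  -- This gives T_{m+1}(1) = 2 T_m(2), which cancels the remaining constants.
  have := treeCount_succ_succ m 0
  rw [treeCount_succ_zero] at this
  simp only [zero_add] at this ⊢
  linarith

/-! ### Inserting a new maximum into a permutation -/

/-- The permutation of length `n + 1` obtained from `π` by inserting a new largest letter at
position `p`. -/
def insertMax {n : ℕ} (π : Equiv.Perm (Fin n)) (p : Fin (n + 1)) : Equiv.Perm (Fin (n + 1)) :=
  (finSuccEquiv' p).trans ((Equiv.optionCongr π).trans (finSuccEquiv' (Fin.last n)).symm)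

@[simp]
theorem insertMax_self {n : ℕ} (π : Equiv.Perm (Fin n)) (p : Fin (n + 1)) :
    insertMax π p p = Fin.last n := by
  simp [insertMax]

@[simp]
theorem insertMax_succAbove {n : ℕ} (π : Equiv.Perm (Fin n)) (p : Fin (n + 1)) (i : Fin n) :
    insertMax π p (p.succAbove i) = (π i).castSucc := by
  simp [insertMax]

theorem insertMax_bijective (n : ℕ) :
    Function.Bijective fun y : Equiv.Perm (Fin n) × Fin (n + 1) => insertMax y.1 y.2 := by
  rw [Fintype.bijective_iff_injective_and_card]
  constructor
  · rintro ⟨π, p⟩ ⟨σ, q⟩ h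
    simp only at h
    have hpq : p = q := by
      apply (insertMax σ q).injective
      rw [← h, insertMax_self, h, insertMax_self]
    subst hpq
    have : π = σ := by
      ext i
      have := congrArg (fun τ : Equiv.Perm (Fin (n + 1)) => (τ (p.succAbove i) : ℕ)) h
      simpa using this
    rw [this]
  · simp [Fintype.card_perm, Nat.factorial_succ, mul_comm]

/-- The position, after the insertion of a letter at position `p`, of the letter at
position `i`. -/
def shiftPos (p i : ℕ) : ℕ := if i < p then i else i + 1

/-- The gap of a word that becomes the gap `s` when a letter is inserted in the gap `p`. The gap
`s` lies to the left of the letter at position `s`. -/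
def collapseGap (p s : ℕ) : ℕ := if s ≤ p then s else s - 1

theorem val_succAbove {n : ℕ} (p : Fin (n + 1)) (i : Fin n) :
    (p.succAbove i : ℕ) = shiftPos p i := by
  unfold shiftPos Fin.succAbove
  simp only [Fin.lt_def, Fin.val_castSucc]
  split <;> simp

theorem collapseGap_self (p : ℕ) : collapseGap p p = p := by simp [collapseGap]

theorem collapseGap_shiftPos (p i : ℕ) : collapseGap p (shiftPos p i) = i := by
  unfold collapseGap shiftPos
  split_ifs <;> omega

/-- A relation `R i j k s t` between three positions `i, j, k` and two gaps `s, t` that is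
symmetric in the gaps and depends only on the relative order of its arguments. -/
structure IsConfiguration (R : ℕ → ℕ → ℕ → ℕ → ℕ → Prop) : Prop where
  symm : ∀ {i j k s t}, R i j k s t → R i j k t s
  shift : ∀ {p i j k s t}, R (shiftPos p i) (shiftPos p j) (shiftPos p k) s t ↔
    R i j k (collapseGap p s) (collapseGap p t)

/-! ### Effect of an insertion on configurations, active gaps and conflicts -/

section Configuration

variable (R : ℕ → ℕ → ℕ → ℕ → ℕ → Prop) {n : ℕ} (π : Equiv.Perm (Fin n))

/-- Some letter of `π`, two smaller letters and two larger letters are in the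
configuration `R`. -/
def HasConfiguration : Prop :=
  ∃ i j k l m : Fin n, l ≠ m ∧ R i j k l m ∧ π j < π i ∧ π k < π i ∧ π i < π l ∧ π i < π m

/-- A new maximum can be inserted in the gap `s` without creating the configuration `R`. -/
def ActiveGap (s : ℕ) : Prop :=
  ¬ ∃ i j k l : Fin n, R i j k s l ∧ π j < π i ∧ π k < π i ∧ π i < π l

/-- Two new maxima cannot both be inserted in the gaps `s` and `t` without creating the
configuration `R`. -/
def ConflictingGaps (s t : ℕ) : Prop :=
  ∃ i j k : Fin n, R i j k s t ∧ π j < π i ∧ π k < π i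

variable {R}

/-- The new maximum can only be one of the two large letters. Identifying a letter with the gap just
to its left lets the same `R` serve for letters and gaps. -/
theorem hasConfiguration_insertMax (hR : IsConfiguration R) (p : Fin (n + 1)) :
    HasConfiguration R (insertMax π p) ↔ HasConfiguration R π ∨ ¬ ActiveGap R π p := by
  have lt : ∀ x : Fin n, ¬ Fin.last n < x.castSucc := fun x => not_lt_of_ge (Fin.le_last _)
  simp only [HasConfiguration, ActiveGap, Fin.exists_iff_succAbove p, insertMax_self,
    insertMax_succAbove, lt, lt_irrefl, and_false, false_and, exists_false, false_or, or_false,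
    not_not, val_succAbove, hR.shift, collapseGap_self, collapseGap_shiftPos,
    Fin.castSucc_lt_castSucc_iff, Fin.castSucc_lt_last, and_true, true_and, ne_eq,
    Fin.succAbove_right_inj, not_true_eq_false]
  constructor
  · rintro ⟨i, j, k, ⟨l, h⟩ | ⟨l, ⟨h⟩ | ⟨m, h⟩⟩⟩
    · exact .inr ⟨i, j, k, l, h.2.1, h.2.2.1, h.2.2.2.1, h.2.2.2.2⟩
    · exact .inr ⟨i, j, k, l, hR.symm h.2.1, h.2.2.1, h.2.2.2.1, h.2.2.2.2⟩
    · exact .inl ⟨i, j, k, l, m, h⟩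
  · rintro (⟨i, j, k, l, m, h⟩ | ⟨i, j, k, l, h⟩)
    · exact ⟨i, j, k, .inr ⟨l, .inr ⟨m, h⟩⟩⟩
    · exact ⟨i, j, k, .inl ⟨l, (Fin.succAbove_ne p l).symm, h⟩⟩

/-- A new obstruction must use the new maximum as its large letter, which is a conflict with the gap
`p`. -/
theorem activeGap_insertMax (hR : IsConfiguration R) (p : Fin (n + 1)) (s : ℕ) :
    ActiveGap R (insertMax π p) s ↔
      ActiveGap R π (collapseGap p s) ∧ ¬ ConflictingGaps R π (collapseGap p s) p := by
  have lt : ∀ x : Fin n, ¬ Fin.last n < x.castSucc := fun x => not_lt_of_ge (Fin.le_last _)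
  simp only [ConflictingGaps, ActiveGap, Fin.exists_iff_succAbove p, insertMax_self,
    insertMax_succAbove, lt, lt_irrefl, and_false, false_and, exists_false, false_or, or_false,
    val_succAbove, hR.shift, collapseGap_self, collapseGap_shiftPos,
    Fin.castSucc_lt_castSucc_iff, Fin.castSucc_lt_last, and_true]
  rw [← not_or, not_iff_not]
  constructor
  · rintro ⟨i, j, k, h | ⟨l, h⟩⟩
    · exact .inr ⟨i, j, k, h⟩
    · exact .inl ⟨i, j, k, l, h⟩
  · rintro (⟨i, j, k, l, h⟩ | ⟨i, j, k, h⟩)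
    · exact ⟨i, j, k, .inr ⟨l, h⟩⟩
    · exact ⟨i, j, k, .inl h⟩

/-- Here the new maximum can only be the middle letter; all other letters are smaller, so only
positions matter. -/
theorem conflictingGaps_insertMax (hR : IsConfiguration R) (p : Fin (n + 1)) (s t : ℕ) :
    ConflictingGaps R (insertMax π p) s t ↔
      ConflictingGaps R π (collapseGap p s) (collapseGap p t) ∨
        ∃ j k : Fin n, R p (shiftPos p j) (shiftPos p k) s t := by
  have lt : ∀ x : Fin n, ¬ Fin.last n < x.castSucc := fun x => not_lt_of_ge (Fin.le_last _)
  simp only [ConflictingGaps, Fin.exists_iff_succAbove p, insertMax_self,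
    insertMax_succAbove, lt, lt_irrefl, and_false, false_and, exists_false, false_or, or_false,
    val_succAbove, hR.shift, Fin.castSucc_lt_castSucc_iff, Fin.castSucc_lt_last, and_true]
  rw [or_comm]

theorem ncard_not_hasConfiguration (hR : IsConfiguration R) (n : ℕ) :
    ({π : Equiv.Perm (Fin n) | ¬ HasConfiguration R π}.ncard : ℤ)
      = descendants insertMax (fun π => ¬ HasConfiguration R π) n
        (default : Equiv.Perm (Fin 0)) := by
  refine ncard_good_eq_descendants (X := fun n => Equiv.Perm (Fin n)) insertMax
    (fun π => ¬ HasConfiguration R π) insertMax_bijective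
    (fun x p h h' => h ((hasConfiguration_insertMax x hR p).2 (.inl h'))) ?_ n
  rintro ⟨i, -⟩
  exact i.elim0

/-- The children of a node of the generating tree correspond to the active gaps. -/
theorem descendants_insertMax_succ (hR : IsConfiguration R) (hπ : ¬ HasConfiguration R π)
    (m : ℕ) (g : ℕ → ℤ)
    (h₁ : ∀ p : Fin (n + 1), ¬ HasConfiguration R (insertMax π p) → ActiveGap R π p →
      descendants insertMax (fun π => ¬ HasConfiguration R π) m (insertMax π p) = g p)
    (h₂ : ∀ p ≤ n, ¬ ActiveGap R π p → g p = 0) :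
    descendants insertMax (fun π => ¬ HasConfiguration R π) (m + 1) π
      = ∑ p ∈ Finset.range (n + 1), g p := by
  rw [descendants, ← Fin.sum_univ_eq_sum_range]
  refine Finset.sum_congr rfl fun p _ => ?_
  have := hasConfiguration_insertMax π hR p
  split_ifs with h
  · exact (h₂ p (by omega) (by tauto)).symm
  · exact h₁ p h (by_contra fun hc => h (this.2 (.inr hc)))

theorem activeGap_of_length_zero (π : Equiv.Perm (Fin 0)) (s : ℕ) : ActiveGap R π s :=
  fun ⟨i, _⟩ => i.elim0

theorem not_conflictingGaps_of_length_zero (π : Equiv.Perm (Fin 0)) (s t : ℕ) :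
    ¬ ConflictingGaps R π s t :=
  fun ⟨i, _⟩ => i.elim0

theorem not_hasConfiguration_of_length_zero (π : Equiv.Perm (Fin 0)) : ¬ HasConfiguration R π :=
  fun ⟨i, _⟩ => i.elim0

end Configuration

theorem collapseGap_le {n p s : ℕ} (hp : p ≤ n) (hs : s ≤ n + 1) : collapseGap p s ≤ n := by
  unfold collapseGap
  split_ifs <;> omega

/-- The second succession rule. Its child labels differ from those of `treeCount₂_succ`, but
affinity in `k` makes the totals equal. -/
theorem treeCount₂_succ_succ (m h k : ℕ) :
    treeCount₂ (m + 1) h (k + 1)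
      = ∑ i ∈ Finset.range h, treeCount₂ m (i + 1) (h - i + (k + 1))
        + 2 * treeCount₂ m (h + 1) (k + 1) + k * treeCount₂ m h 1 := by
  rw [treeCount₂_succ, Finset.sum_range_succ, treeCount₂_one_right]
  simp only [treeCount₂, Nat.sub_self, zero_add]
  push_cast
  ring

/-! ### Two larger letters to the left, two smaller letters to the right -/

/-- The configuration of the patterns `45312`, `45321`, `54312` and `54321`. -/
def HighHighMidLowLow (i j k s t : ℕ) : Prop := s ≤ i ∧ t ≤ i ∧ i < j ∧ j < k

theorem isConfiguration_highHighMidLowLow : IsConfiguration HighHighMidLowLow where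
  symm := by unfold HighHighMidLowLow; tauto
  shift := by
    intro p i j k s t
    unfold HighHighMidLowLow shiftPos collapseGap
    split_ifs <;> omega

theorem conflictingGaps_highHighMidLowLow {n : ℕ} (π : Equiv.Perm (Fin n)) (p : Fin (n + 1))
    (s t : ℕ) :
    ConflictingGaps HighHighMidLowLow (insertMax π p) s t ↔
      ConflictingGaps HighHighMidLowLow π (collapseGap p s) (collapseGap p t) ∨
        p + 2 ≤ n ∧ s ≤ p ∧ t ≤ p := by
  rw [conflictingGaps_insertMax _ isConfiguration_highHighMidLowLow]
  refine or_congr_right ⟨?_, ?_⟩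
  · rintro ⟨j, k, h⟩
    unfold HighHighMidLowLow shiftPos at h
    split_ifs at h <;> omega
  · intro h
    -- The two letters just right of the new maximum.
    refine ⟨⟨p, by omega⟩, ⟨p + 1, by omega⟩, ?_⟩
    simp [HighHighMidLowLow, shiftPos, h]

/-- Gaps below `y` are dead, the next `k` conflict pairwise and with themselves, and the last `h +
2` are free; the last two gaps are always free, having fewer than two letters to their right. -/
theorem descendants_highHighMidLowLow (m : ℕ) {n : ℕ} (π : Equiv.Perm (Fin n)) (y k h : ℕ)
    (hn : n = y + k + h + 1) (hπ : ¬ HasConfiguration HighHighMidLowLow π)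
    (hact : ∀ s ≤ n, ActiveGap HighHighMidLowLow π s ↔ y ≤ s)
    (hconf : ∀ s ≤ n, ∀ t ≤ n,
      ConflictingGaps HighHighMidLowLow π s t ↔ s < y + k ∧ t < y + k) :
    descendants insertMax (fun π => ¬ HasConfiguration HighHighMidLowLow π) m π
      = treeCount₂ m h (k + 1) := by
  induction m generalizing n y k h with
  | zero => simp [descendants, treeCount₂_zero]
  | succ m ih =>
    have hR := isConfiguration_highHighMidLowLow
    -- A conflicting gap kills all conflicting ones and leaves only the free part. A free gap other
    -- than the last two makes the gaps up to it conflict; the last two only add a free gap.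
    rw [descendants_insertMax_succ π hR hπ m
      (fun p => if p < y then 0 else if p < y + k then treeCount₂ m h 1
        else if p < y + k + h then treeCount₂ m (y + k + h - p) (p - y + 1 + 1)
        else treeCount₂ m (h + 1) (k + 1))]
    · have e : n + 1 = y + (k + (h + 2)) := by omega
      rw [e, Finset.sum_range_add, Finset.sum_range_add, Finset.sum_range_add,
        treeCount₂_succ_succ]
      have h1 : ∀ p ∈ Finset.range y, (if p < y then (0 : ℤ) else if p < y + k
          then treeCount₂ m h 1
          else if p < y + k + h then treeCount₂ m (y + k + h - p) (p - y + 1 + 1)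
          else treeCount₂ m (h + 1) (k + 1)) = 0 := by
        intro p hp
        rw [if_pos (Finset.mem_range.1 hp)]
      rw [Finset.sum_eq_zero h1]
      have h2 : ∀ p ∈ Finset.range k, (if y + p < y then (0 : ℤ) else if y + p < y + k
          then treeCount₂ m h 1
          else if y + p < y + k + h then treeCount₂ m (y + k + h - (y + p)) (y + p - y + 1 + 1)
          else treeCount₂ m (h + 1) (k + 1)) = treeCount₂ m h 1 := by
        intro p hp
        have := Finset.mem_range.1 hp
        rw [if_neg (by omega), if_pos (by omega)]
      rw [Finset.sum_congr rfl h2]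
      have h3 : ∀ p ∈ Finset.range h, (if y + (k + p) < y then (0 : ℤ)
          else if y + (k + p) < y + k then treeCount₂ m h 1
          else if y + (k + p) < y + k + h
            then treeCount₂ m (y + k + h - (y + (k + p))) (y + (k + p) - y + 1 + 1)
          else treeCount₂ m (h + 1) (k + 1))
          = treeCount₂ m (h - 1 - p + 1) (h - (h - 1 - p) + (k + 1)) := by
        intro p hp
        have := Finset.mem_range.1 hp
        rw [if_neg (by omega), if_neg (by omega), if_pos (by omega)]
        congr 1 <;> omega
      rw [Finset.sum_congr rfl h3, Finset.sum_range_reflect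
        (fun i => treeCount₂ m (i + 1) (h - i + (k + 1)))]
      simp only [Finset.sum_range_succ, Finset.sum_range_zero, Finset.sum_const,
        Finset.card_range, nsmul_eq_mul]
      rw [if_neg (by omega), if_neg (by omega), if_neg (by omega), if_neg (by omega),
        if_neg (by omega), if_neg (by omega)]
      ring
    · intro p hp hpa
      have hpn : (p : ℕ) ≤ n := by omega
      rw [hact p hpn] at hpa
      have act := fun s (hs : s ≤ n + 1) => hact _ (collapseGap_le hpn hs)
      have conf := fun s (hs : s ≤ n + 1) t (ht : t ≤ n + 1) =>
        hconf _ (collapseGap_le hpn hs) _ (collapseGap_le hpn ht)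
      have confp := fun s (hs : s ≤ n + 1) => hconf _ (collapseGap_le hpn hs) p hpn
      rw [if_neg (by omega)]
      split_ifs with h1 h2
      · refine ih _ (y + k + 1) 0 h (by omega) hp ?_ ?_
        · intro s hs
          rw [activeGap_insertMax _ hR, act s hs, confp s hs]
          unfold collapseGap
          split_ifs <;> omega
        · intro s hs t ht
          rw [conflictingGaps_highHighMidLowLow, conf s hs t ht]
          unfold collapseGap
          split_ifs <;> omega
      · refine ih _ y (p - y + 1) (y + k + h - p) (by omega) hp ?_ ?_
        · intro s hs
          rw [activeGap_insertMax _ hR, act s hs, confp s hs]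
          unfold collapseGap
          split_ifs <;> omega
        · intro s hs t ht
          rw [conflictingGaps_highHighMidLowLow, conf s hs t ht]
          unfold collapseGap
          split_ifs <;> omega
      · refine ih _ y k (h + 1) (by omega) hp ?_ ?_
        · intro s hs
          rw [activeGap_insertMax _ hR, act s hs, confp s hs]
          unfold collapseGap
          split_ifs <;> omega
        · intro s hs t ht
          rw [conflictingGaps_highHighMidLowLow, conf s hs t ht]
          unfold collapseGap
          split_ifs <;> omega
    · intro p hp hpa
      rw [hact p hp] at hpa
      rw [if_pos (by omega)]

theorem ncard_not_highHighMidLowLow (n : ℕ) :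
    ({π : Equiv.Perm (Fin n) | ¬ HasConfiguration HighHighMidLowLow π}.ncard : ℤ)
      = treeCount n 0 := by
  have hR := isConfiguration_highHighMidLowLow
  rw [ncard_not_hasConfiguration hR]
  -- The invariant needs two free gaps, so it starts at length one.
  cases n with
  | zero => simp [descendants, treeCount]
  | succ m =>
    rw [descendants_insertMax_succ _ hR (not_hasConfiguration_of_length_zero _) m
      (fun _ => treeCount m 1)]
    · simp [treeCount_succ_zero]
    · intro p hp _
      rw [descendants_highHighMidLowLow m _ 0 0 0 rfl hp, treeCount₂_one_right]
      · intro s _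
        rw [activeGap_insertMax _ hR]
        simp [activeGap_of_length_zero, not_conflictingGaps_of_length_zero]
      · intro s _ t _
        rw [conflictingGaps_highHighMidLowLow]
        simp [not_conflictingGaps_of_length_zero]
    · exact fun p _ h => absurd (activeGap_of_length_zero _ _) h

/-! ### Two smaller letters, then two larger letters to the right -/

/-- The configuration of the patterns `31245`, `32145`, `31254` and `32154`. -/
def MidLowLowHighHigh (i j k s t : ℕ) : Prop := i < j ∧ j < k ∧ k < s ∧ k < t

theorem isConfiguration_midLowLowHighHigh : IsConfiguration MidLowLowHighHigh where
  symm := by unfold MidLowLowHighHigh; tauto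
  shift := by
    intro p i j k s t
    unfold MidLowLowHighHigh shiftPos collapseGap
    split_ifs <;> omega

theorem conflictingGaps_midLowLowHighHigh {n : ℕ} (π : Equiv.Perm (Fin n)) (p : Fin (n + 1))
    {s t : ℕ} (hs : s ≤ n + 1) :
    ConflictingGaps MidLowLowHighHigh (insertMax π p) s t ↔
      ConflictingGaps MidLowLowHighHigh π (collapseGap p s) (collapseGap p t) ∨
        p + 3 ≤ s ∧ p + 3 ≤ t := by
  rw [conflictingGaps_insertMax _ isConfiguration_midLowLowHighHigh]
  refine or_congr_right ⟨?_, ?_⟩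
  · rintro ⟨j, k, h⟩
    unfold MidLowLowHighHigh shiftPos at h
    split_ifs at h <;> omega
  · intro h
    refine ⟨⟨p, by omega⟩, ⟨p + 1, by omega⟩, ?_⟩
    simp [MidLowLowHighHigh, shiftPos]
    omega

/-- The first `h + 2` gaps are free, the next `k` conflict pairwise and with themselves, and the
rest are dead. -/
theorem descendants_midLowLowHighHigh (m : ℕ) {n : ℕ} (π : Equiv.Perm (Fin n)) (h k : ℕ)
    (hn : h + 2 + k ≤ n + 1) (hπ : ¬ HasConfiguration MidLowLowHighHigh π)
    (hact : ∀ s ≤ n, ActiveGap MidLowLowHighHigh π s ↔ s < h + 2 + k)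
    (hconf : ∀ s ≤ n, ∀ t ≤ n,
      ConflictingGaps MidLowLowHighHigh π s t ↔ h + 2 ≤ s ∧ h + 2 ≤ t) :
    descendants insertMax (fun π => ¬ HasConfiguration MidLowLowHighHigh π) m π
      = treeCount₂ m h (k + 1) := by
  induction m generalizing n k h with
  | zero => simp [descendants, treeCount₂_zero]
  | succ m ih =>
    have hR := isConfiguration_midLowLowHighHigh
    rw [descendants_insertMax_succ π hR hπ m
      (fun p => if p < h then treeCount₂ m (p + 1) (h - p + (k + 1))
        else if p < h + 2 then treeCount₂ m (h + 1) (k + 1)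
        else if p < h + 2 + k then treeCount₂ m h 1 else 0)]
    · obtain ⟨d, hd⟩ := Nat.exists_eq_add_of_le hn
      rw [hd, Finset.sum_range_add, Finset.sum_range_add, Finset.sum_range_add,
        treeCount₂_succ_succ]
      have h1 : ∀ p ∈ Finset.range h, (if p < h then treeCount₂ m (p + 1) (h - p + (k + 1))
        else if p < h + 2 then treeCount₂ m (h + 1) (k + 1)
        else if p < h + 2 + k then treeCount₂ m h 1 else 0)
          = treeCount₂ m (p + 1) (h - p + (k + 1)) := by
        intro p hp
        rw [if_pos (Finset.mem_range.1 hp)]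
      have h2 : ∀ p ∈ Finset.range k, (if h + 2 + p < h
          then treeCount₂ m (h + 2 + p + 1) (h - (h + 2 + p) + (k + 1))
        else if h + 2 + p < h + 2 then treeCount₂ m (h + 1) (k + 1)
        else if h + 2 + p < h + 2 + k then treeCount₂ m h 1 else 0) = treeCount₂ m h 1 := by
        intro p hp
        have := Finset.mem_range.1 hp
        rw [if_neg (by omega), if_neg (by omega), if_pos (by omega)]
      have h3 : ∀ p ∈ Finset.range d, (if h + 2 + k + p < h
          then treeCount₂ m (h + 2 + k + p + 1) (h - (h + 2 + k + p) + (k + 1))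
        else if h + 2 + k + p < h + 2 then treeCount₂ m (h + 1) (k + 1)
        else if h + 2 + k + p < h + 2 + k then treeCount₂ m h 1 else 0) = 0 := by
        intro p hp
        rw [if_neg (by omega), if_neg (by omega), if_neg (by omega)]
      rw [Finset.sum_congr rfl h1, Finset.sum_congr rfl h2, Finset.sum_eq_zero h3]
      simp only [Finset.sum_range_succ, Finset.sum_range_zero, Finset.sum_const,
        Finset.card_range, nsmul_eq_mul]
      rw [if_neg (by omega), if_pos (by omega), if_neg (by omega), if_pos (by omega)]
      ring
    · intro p hp hpa
      have hpn : (p : ℕ) ≤ n := by omega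
      rw [hact p hpn] at hpa
      have act := fun s (hs : s ≤ n + 1) => hact _ (collapseGap_le hpn hs)
      have conf := fun s (hs : s ≤ n + 1) t (ht : t ≤ n + 1) =>
        hconf _ (collapseGap_le hpn hs) _ (collapseGap_le hpn ht)
      have confp := fun s (hs : s ≤ n + 1) => hconf _ (collapseGap_le hpn hs) p hpn
      split_ifs with h1 h2
      · have e : h - p + (k + 1) = h - p + k + 1 := by omega
        rw [e]
        refine ih _ (p + 1) (h - p + k) (by omega) hp ?_ ?_
        · intro s hs
          rw [activeGap_insertMax _ hR, act s hs, confp s hs]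
          unfold collapseGap
          split_ifs <;> omega
        · intro s hs t ht
          rw [conflictingGaps_midLowLowHighHigh _ _ hs, conf s hs t ht]
          unfold collapseGap
          split_ifs <;> omega
      · refine ih _ (h + 1) k (by omega) hp ?_ ?_
        · intro s hs
          rw [activeGap_insertMax _ hR, act s hs, confp s hs]
          unfold collapseGap
          split_ifs <;> omega
        · intro s hs t ht
          rw [conflictingGaps_midLowLowHighHigh _ _ hs, conf s hs t ht]
          unfold collapseGap
          split_ifs <;> omega
      · refine ih _ h 0 (by omega) hp ?_ ?_
        · intro s hs
          rw [activeGap_insertMax _ hR, act s hs, confp s hs]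
          unfold collapseGap
          split_ifs <;> omega
        · intro s hs t ht
          rw [conflictingGaps_midLowLowHighHigh _ _ hs, conf s hs t ht]
          unfold collapseGap
          split_ifs <;> omega
    · intro p hp hpa
      rw [hact p hp] at hpa
      rw [if_neg (by omega), if_neg (by omega), if_neg (by omega)]

theorem ncard_not_midLowLowHighHigh (n : ℕ) :
    ({π : Equiv.Perm (Fin n) | ¬ HasConfiguration MidLowLowHighHigh π}.ncard : ℤ)
      = treeCount n 0 := by
  have hR := isConfiguration_midLowLowHighHigh
  rw [ncard_not_hasConfiguration hR]
  cases n with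
  | zero => simp [descendants, treeCount]
  | succ m =>
    rw [descendants_insertMax_succ _ hR (not_hasConfiguration_of_length_zero _) m
      (fun _ => treeCount m 1)]
    · simp [treeCount_succ_zero]
    · intro p hp _
      rw [descendants_midLowLowHighHigh m _ 0 0 le_rfl hp, treeCount₂_one_right]
      · intro s _
        rw [activeGap_insertMax _ hR]
        simp [activeGap_of_length_zero, not_conflictingGaps_of_length_zero]
        omega
      · intro s hs t _
        rw [conflictingGaps_midLowLowHighHigh _ _ hs]
        simp [not_conflictingGaps_of_length_zero]
        omega
    · exact fun p _ h => absurd (activeGap_of_length_zero _ _) h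

/-! ### A smaller, a larger, a smaller and a larger letter to the right -/

/-- The configuration of the patterns `31425`, `32415`, `31524` and `32514`. -/
def MidLowHighLowHigh (i j k s t : ℕ) : Prop :=
  i < j ∧ j < s ∧ j < t ∧ (s ≤ k ∧ k < t ∨ t ≤ k ∧ k < s)

theorem isConfiguration_midLowHighLowHigh : IsConfiguration MidLowHighLowHigh where
  symm := by unfold MidLowHighLowHigh; tauto
  shift := by
    intro p i j k s t
    unfold MidLowHighLowHigh shiftPos collapseGap
    split_ifs <;> omega

theorem conflictingGaps_midLowHighLowHigh {n : ℕ} (π : Equiv.Perm (Fin n)) (p : Fin (n + 1))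
    {s t : ℕ} (hst : s < t) (ht : t ≤ n + 1) :
    ConflictingGaps MidLowHighLowHigh (insertMax π p) s t ↔
      ConflictingGaps MidLowHighLowHigh π (collapseGap p s) (collapseGap p t) ∨ p + 2 ≤ s := by
  rw [conflictingGaps_insertMax _ isConfiguration_midLowHighLowHigh]
  refine or_congr_right ⟨?_, ?_⟩
  · rintro ⟨j, k, h⟩
    unfold MidLowHighLowHigh shiftPos at h
    split_ifs at h <;> omega
  · intro h
    -- The letter just after the new maximum, and the letter just right of the gap `s`.
    refine ⟨⟨p, by omega⟩, ⟨s - 1, by omega⟩, ?_⟩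
    simp only [MidLowHighLowHigh, shiftPos]
    split_ifs <;> omega

theorem not_conflictingGaps_self_midLowHighLowHigh {n : ℕ} (π : Equiv.Perm (Fin n)) (s : ℕ) :
    ¬ ConflictingGaps MidLowHighLowHigh π s s := by
  rintro ⟨i, j, k, h, -⟩
  unfold MidLowHighLowHigh at h
  omega

theorem conflictingGaps_comm {R : ℕ → ℕ → ℕ → ℕ → ℕ → Prop} (hR : IsConfiguration R) {n : ℕ}
    (π : Equiv.Perm (Fin n)) (s t : ℕ) : ConflictingGaps R π s t ↔ ConflictingGaps R π t s :=
  ⟨fun ⟨i, j, k, h⟩ => ⟨i, j, k, hR.symm h.1, h.2⟩, fun ⟨i, j, k, h⟩ => ⟨i, j, k, hR.symm h.1, h.2⟩⟩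

/-- Used because a child's label depends only on the rank of `p` in the chain. -/
theorem sum_card_filter_lt (C : Finset ℕ) (g : ℕ → ℤ) :
    ∑ p ∈ C, g (C.filter (· < p)).card = ∑ i ∈ Finset.range C.card, g i := by
  induction C using Finset.induction_on_max with
  | empty => simp
  | insert a s h ih =>
    have ha : a ∉ s := fun h' => lt_irrefl _ (h a h')
    rw [Finset.sum_insert ha, Finset.card_insert_of_notMem ha, Finset.sum_range_succ, ← ih,
      add_comm]
    congr 1
    · refine Finset.sum_congr rfl fun p hp => ?_
      rw [Finset.filter_insert, if_neg (not_lt_of_gt (h p hp))]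
    · rw [Finset.filter_insert, if_neg (lt_irrefl _), Finset.filter_true_of_mem h]

/-- The active gaps split into a chain `C` of gaps that conflict with no other active gap,
followed by a set `L` of pairwise conflicting gaps. -/
theorem descendants_midLowHighLowHigh (m : ℕ) {n : ℕ} (π : Equiv.Perm (Fin n)) (C L : Finset ℕ)
    (h k : ℕ) (hCcard : C.card = h + 1) (hLcard : L.card = k)
    (hC : ∀ s ∈ C, s ≤ n) (hL : ∀ s ∈ L, s ≤ n) (hCL : ∀ s ∈ C, ∀ t ∈ L, s < t)
    (hπ : ¬ HasConfiguration MidLowHighLowHigh π)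
    (hact : ∀ s ≤ n, ActiveGap MidLowHighLowHigh π s ↔ s ∈ C ∨ s ∈ L)
    (hconf : ∀ s t, s < t → (s ∈ C ∨ s ∈ L) → (t ∈ C ∨ t ∈ L) →
      (ConflictingGaps MidLowHighLowHigh π s t ↔ s ∈ L)) :
    descendants insertMax (fun π => ¬ HasConfiguration MidLowHighLowHigh π) m π
      = treeCount₂ m h k := by
  induction m generalizing n C L h k with
  | zero => simp [descendants, treeCount₂_zero]
  | succ m ih =>
    have hR := isConfiguration_midLowHighLowHigh
    have hdisj : Disjoint C L :=
      Finset.disjoint_left.2 fun s hs ht => lt_irrefl _ (hCL s hs s ht)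
    -- Inserting in `C` kills nothing, splits `p` into two chain gaps and moves the later gaps of
    -- `C` into `L`. Inserting in `L` kills the rest of `L`, while `p`, which does not conflict with
    -- itself, adds two gaps to the chain.
    rw [descendants_insertMax_succ π hR hπ m (fun p => if p ∈ C then
        treeCount₂ m ((C.filter (· < p)).card + 1) (h - (C.filter (· < p)).card + k)
        else if p ∈ L then treeCount m (h + 2) else 0)]
    · have hsub : C ∪ L ⊆ Finset.range (n + 1) := by
        intro s hs
        rw [Finset.mem_range, Nat.lt_succ_iff]
        exact (Finset.mem_union.1 hs).elim (hC s) (hL s)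
      rw [← Finset.sum_subset hsub, Finset.sum_union hdisj, treeCount₂_succ, ← hCcard,
        ← sum_card_filter_lt C (fun i => treeCount₂ m (i + 1) (h - i + k))]
      · congr 1
        · exact Finset.sum_congr rfl fun p hp => by rw [if_pos hp]
        · have : ∀ p ∈ L, (if p ∈ C then
              treeCount₂ m ((C.filter (· < p)).card + 1) (h - (C.filter (· < p)).card + k)
              else if p ∈ L then treeCount m (h + 2) else 0) = treeCount m (h + 2) := by
            intro p hp
            rw [if_neg (Finset.disjoint_right.1 hdisj hp), if_pos hp]
          rw [Finset.sum_congr rfl this]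
          simp [hLcard]
      · intro p _ hp
        rw [Finset.mem_union, not_or] at hp
        rw [if_neg hp.1, if_neg hp.2]
    · intro p hp hpa
      have hpn : (p : ℕ) ≤ n := by omega
      rw [hact p hpn] at hpa
      have act := fun s (hs : s ≤ n + 1) => hact _ (collapseGap_le hpn hs)
      have self := not_conflictingGaps_self_midLowHighLowHigh π
      have comm := conflictingGaps_comm hR π
      split_ifs with h1 h2
      · have hcard : C.card = (C.filter (· < (p : ℕ))).card
            + (1 + (C.filter ((p : ℕ) < ·)).card) := by
          have h2 := Finset.card_filter_add_card_filter_not (s := C) (fun s => s < (p : ℕ))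
          have h3 : C.filter (fun s => ¬ s < (p : ℕ)) = insert (p : ℕ) (C.filter ((p : ℕ) < ·)) := by
            ext s
            simp only [Finset.mem_filter, Finset.mem_insert]
            grind
          rw [h3, Finset.card_insert_of_notMem (by simp)] at h2
          omega
        have hC' : ∀ s, s ∈ insert (p + 1 : ℕ) (insert (p : ℕ) (C.filter (· < (p : ℕ)))) ↔
            s = p + 1 ∨ s ≤ p ∧ s ∈ C := by
          intro s
          simp only [Finset.mem_filter, Finset.mem_insert]
          grind
        have hL' : ∀ s : ℕ, s ∈ (C.filter ((p : ℕ) < ·) ∪ L).image (· + 1) ↔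
            (p : ℕ) + 2 ≤ s ∧ (s - 1 ∈ C ∨ s - 1 ∈ L) := by
          intro s
          simp only [Finset.mem_image, Finset.mem_union, Finset.mem_filter]
          constructor
          · rintro ⟨x, hx | hx, rfl⟩
            · exact ⟨by omega, .inl hx.1⟩
            · exact ⟨by have := hCL p h1 x hx; omega, .inr hx⟩
          · rintro ⟨hs, hx⟩
            refine ⟨s - 1, ?_, by omega⟩
            exact hx.imp (fun hx => ⟨hx, by omega⟩) id
        refine ih _ _ _ _ _ (?_ : (insert (p + 1 : ℕ) (insert (p : ℕ)
          (C.filter (· < (p : ℕ))))).card = _) (?_ : ((C.filter ((p : ℕ) < ·) ∪ L).image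
            (· + 1)).card = _) ?_ ?_ ?_ hp ?_ ?_
        · rw [Finset.card_insert_of_notMem (by simp), Finset.card_insert_of_notMem (by simp)]
        · rw [Finset.card_image_of_injective _ (add_left_injective 1), Finset.card_union_of_disjoint
            (hdisj.mono_left (Finset.filter_subset _ _))]
          omega
        · intro s hs
          rw [hC'] at hs
          omega
        · intro s hs
          rw [hL'] at hs
          have := hs.2.elim (hC _) (hL _)
          omega
        · intro s hs t ht
          rw [hC'] at hs
          rw [hL'] at ht
          omega
        · intro s hs
          rw [hC', hL', activeGap_insertMax _ hR, act s hs]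
          have hnc : ∀ t, (t ∈ C ∨ t ∈ L) → ¬ ConflictingGaps MidLowHighLowHigh π t p := by
            intro t ht
            rcases lt_trichotomy t p with hlt | rfl | hlt
            · rw [hconf t p hlt ht (.inl h1)]
              intro htL
              have := hCL p h1 t htL
              omega
            · exact self _
            · rw [comm, hconf p t hlt (.inl h1) ht]
              exact Finset.disjoint_left.1 hdisj h1
          rw [and_iff_left_of_imp (hnc _)]
          unfold collapseGap
          have hlt : ∀ t ∈ L, p < t := hCL p h1
          split_ifs with hsp
          · constructor
            · rintro (h | h)
              · exact .inl (.inr ⟨hsp, h⟩)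
              · have := hlt s h
                omega
            · rintro ((h | h) | h)
              · omega
              · exact .inl h.2
              · omega
          · constructor
            · intro h
              by_cases hs1 : s = p + 1
              · exact .inl (.inl hs1)
              · exact .inr ⟨by omega, h⟩
            · rintro ((rfl | h) | h)
              · exact .inl h1
              · omega
              · exact h.2
        · intro s t hst hs ht
          have htn : t ≤ n + 1 := by
            rcases ht with ht | ht
            · rw [hC'] at ht; omega
            · rw [hL'] at ht
              have := ht.2.elim (hC _) (hL _)
              omega
          rw [hL', conflictingGaps_midLowHighLowHigh _ _ hst htn]
          rcases hs with hs | hs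
          · have hs' := (hC' s).1 hs
            have hsC : collapseGap p s ∈ C := by
              unfold collapseGap
              rcases hs' with rfl | hs'
              · simpa using h1
              · simpa [hs'.1] using hs'.2
            have htCL : collapseGap p t ∈ C ∨ collapseGap p t ∈ L := by
              rw [hC', hL'] at ht
              unfold collapseGap
              rcases ht with (rfl | ht) | ht
              · left; simpa using h1
              · left; simpa [ht.1] using ht.2
              · rw [if_neg (by omega)]
                exact ht.2
            have : ¬ ConflictingGaps MidLowHighLowHigh π (collapseGap p s) (collapseGap p t) := by
              have hle : collapseGap p s ≤ collapseGap p t := by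
                unfold collapseGap
                split_ifs <;> omega
              rcases hle.lt_or_eq with hlt | heq
              · rw [hconf _ _ hlt (.inl hsC) htCL]
                exact Finset.disjoint_left.1 hdisj hsC
              · rw [heq]
                exact self _
            constructor
            · rintro (h | h)
              · exact absurd h this
              · omega
            · intro h
              exact .inr h.1
          · have hs' := (hL' s).1 hs
            exact ⟨fun _ => hs', fun _ => .inr hs'.1⟩
      · have hC' : ∀ s, s ∈ insert (p + 1 : ℕ) (insert (p : ℕ) C) ↔
            s = p + 1 ∨ s = p ∨ s ∈ C := by
          intro s
          simp only [Finset.mem_insert]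
        have hlt : ∀ s ∈ C, s < p := fun s hs => hCL s hs p h2
        rw [← treeCount₂_zero_right]
        refine ih _ (insert (p + 1 : ℕ) (insert (p : ℕ) C)) ∅ _ _ ?_ rfl ?_ (by simp) (by simp)
          hp ?_ ?_
        · have hp1 : (p + 1 : ℕ) ∉ C := fun hs => by have := hlt _ hs; omega
          rw [Finset.card_insert_of_notMem (by simp [hp1]), Finset.card_insert_of_notMem h1,
            hCcard]
        · intro s hs
          rw [hC'] at hs
          rcases hs with rfl | rfl | hs
          · omega
          · omega
          · have := hC s hs
            omega
        · intro s hs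
          simp only [hC', Finset.notMem_empty, or_false]
          rw [activeGap_insertMax _ hR, act s hs]
          have hnc : (collapseGap p s ∈ C ∨ collapseGap p s ∈ L) ∧
              ¬ ConflictingGaps MidLowHighLowHigh π (collapseGap p s) p ↔
              collapseGap p s = p ∨ collapseGap p s ∈ C := by
            generalize collapseGap p s = t
            constructor
            · rintro ⟨ht, hn⟩
              rcases lt_trichotomy t p with hlt' | rfl | hlt'
              · rw [hconf t p hlt' ht (.inr h2)] at hn
                tauto
              · exact .inl rfl
              · rw [comm, hconf p t hlt' (.inr h2) ht] at hn
                exact absurd h2 hn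
            · rintro (rfl | ht)
              · exact ⟨.inr h2, self _⟩
              · refine ⟨.inl ht, ?_⟩
                rw [hconf t p (hlt t ht) (.inl ht) (.inr h2)]
                exact Finset.disjoint_left.1 hdisj ht
          rw [hnc]
          unfold collapseGap
          split_ifs with hsp
          · exact ⟨fun h => .inr h, fun h => h.elim (by omega) id⟩
          · constructor
            · rintro (h | h)
              · left; omega
              · have := hlt _ h
                omega
            · rintro (h | h | h)
              · left; omega
              · omega
              · have := hlt _ h
                omega
        · intro s t hst hs ht
          simp only [hC', Finset.notMem_empty, or_false] at hs ht
          have htn : t ≤ n + 1 := by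
            rcases ht with rfl | rfl | ht
            · omega
            · omega
            · have := hC t ht
              omega
          have hsp : s ≤ p := by
            rcases hs with rfl | rfl | hs
            · rcases ht with rfl | rfl | ht
              · omega
              · omega
              · have := hlt t ht
                omega
            · exact le_rfl
            · exact (hlt s hs).le
          simp only [conflictingGaps_midLowHighLowHigh _ _ hst htn, Finset.notMem_empty, iff_false,
            not_or]
          refine ⟨?_, by omega⟩
          have hs1 : collapseGap p s = s := by simp [collapseGap, hsp]
          rw [hs1]
          have ht1 : collapseGap p t = p ∨ collapseGap p t ∈ C := by
            unfold collapseGap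
            rcases ht with rfl | rfl | ht
            · simp
            · simp
            · simp [(hlt t ht).le, ht]
          have hle : s ≤ collapseGap p t := by
            unfold collapseGap
            split_ifs <;> omega
          rcases hle.lt_or_eq with hlt' | heq
          · have hsC : s ∈ C := by
              rcases hs with rfl | rfl | hs
              · omega
              · rcases ht1 with h | h
                · omega
                · have := hlt _ h
                  omega
              · exact hs
            rw [hconf _ _ hlt' (.inl hsC) (ht1.elim (fun h => .inr (by rwa [h])) .inl)]
            exact Finset.disjoint_left.1 hdisj hsC
          · rw [← heq]
            exact self _
      · tauto
    · intro p hp hpa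
      rw [hact p hp, not_or] at hpa
      rw [if_neg hpa.1, if_neg hpa.2]

theorem ncard_not_midLowHighLowHigh (n : ℕ) :
    ({π : Equiv.Perm (Fin n) | ¬ HasConfiguration MidLowHighLowHigh π}.ncard : ℤ)
      = treeCount n 0 := by
  rw [ncard_not_hasConfiguration isConfiguration_midLowHighLowHigh,
    descendants_midLowHighLowHigh n _ {0} ∅ 0 0 rfl rfl (by simp) (by simp) (by simp)
      (not_hasConfiguration_of_length_zero _), treeCount₂_zero_right]
  · intro s hs
    simpa [activeGap_of_length_zero] using hs
  · intro s t hst hs ht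
    simp at hs ht
    omega

/-! ### A larger and a smaller letter on either side, the smaller ones inside -/

/-- The configuration of the patterns `41325`, `51324`, `42315` and `52314`. -/
def HighLowMidLowHigh (i j k s t : ℕ) : Prop :=
  j < i ∧ i < k ∧ (s ≤ j ∧ k < t ∨ t ≤ j ∧ k < s)

theorem isConfiguration_highLowMidLowHigh : IsConfiguration HighLowMidLowHigh where
  symm := by unfold HighLowMidLowHigh; tauto
  shift := by
    intro p i j k s t
    unfold HighLowMidLowHigh shiftPos collapseGap
    split_ifs <;> omega

theorem conflictingGaps_highLowMidLowHigh {n : ℕ} (π : Equiv.Perm (Fin n)) (p : Fin (n + 1))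
    {s t : ℕ} (hs : s ≤ n + 1) (ht : t ≤ n + 1) :
    ConflictingGaps HighLowMidLowHigh (insertMax π p) s t ↔
      ConflictingGaps HighLowMidLowHigh π (collapseGap p s) (collapseGap p t) ∨
        (s < p ∧ p + 2 ≤ t ∨ t < p ∧ p + 2 ≤ s) := by
  rw [conflictingGaps_insertMax _ isConfiguration_highLowMidLowHigh]
  refine or_congr_right ⟨?_, ?_⟩
  · rintro ⟨j, k, h⟩
    unfold HighLowMidLowHigh shiftPos at h
    split_ifs at h <;> omega
  · intro h
    -- The two neighbours of the new maximum.
    refine ⟨⟨p - 1, by omega⟩, ⟨p, by omega⟩, ?_⟩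
    simp only [HighLowMidLowHigh, shiftPos]
    split_ifs <;> omega

/-- The active gaps form an interval around the position `lo + a` of the last inserted
maximum. -/
theorem descendants_highLowMidLowHigh (m : ℕ) {n : ℕ} (π : Equiv.Perm (Fin n)) (lo a b : ℕ)
    (hn : lo + a + b + 1 ≤ n) (hπ : ¬ HasConfiguration HighLowMidLowHigh π)
    (hact : ∀ s ≤ n, ActiveGap HighLowMidLowHigh π s ↔ lo ≤ s ∧ s ≤ lo + a + b + 1)
    (hconf : ∀ s t, lo ≤ s → s ≤ lo + a + b + 1 → lo ≤ t → t ≤ lo + a + b + 1 →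
      (ConflictingGaps HighLowMidLowHigh π s t ↔
        s < lo + a ∧ lo + a + 2 ≤ t ∨ t < lo + a ∧ lo + a + 2 ≤ s)) :
    descendants insertMax (fun π => ¬ HasConfiguration HighLowMidLowHigh π) m π
      = symmTreeCount m a b := by
  induction m generalizing n lo a b with
  | zero => simp [descendants, symmTreeCount, treeCount]
  | succ m ih =>
    have hR := isConfiguration_highLowMidLowHigh
    -- Inserting among the `a` left gaps kills the `b` right ones and vice versa; the two gaps
    -- beside the last maximum conflict with nothing.
    obtain ⟨g, hg⟩ : ∃ g : ℕ → ℤ, g = fun p => if p < lo then 0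
        else if p < lo + a then symmTreeCount m (p - lo) (a + 1 - (p - lo))
        else if p = lo + a then symmTreeCount m a (b + 1)
        else if p = lo + a + 1 then symmTreeCount m (a + 1) b
        else if p < lo + a + b + 2 then
          symmTreeCount m (p - (lo + a + 2) + 2) (b - 1 - (p - (lo + a + 2)))
        else 0 := ⟨_, rfl⟩
    rw [descendants_insertMax_succ π hR hπ m g]
    · obtain ⟨d, hd⟩ := Nat.exists_eq_add_of_le hn
      have e : n + 1 = lo + (a + (2 + (b + d))) := by omega
      rw [e, Finset.sum_range_add, Finset.sum_range_add, Finset.sum_range_add,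
        Finset.sum_range_add, symmTreeCount_succ]
      have h1 : ∀ p ∈ Finset.range lo, g p = 0 := by
        intro p hp
        rw [hg]
        simp only
        rw [if_pos (Finset.mem_range.1 hp)]
      have h2 : ∀ p ∈ Finset.range a, g (lo + p) = symmTreeCount m p (a + 1 - p) := by
        intro p hp
        have := Finset.mem_range.1 hp
        rw [hg]
        simp only
        rw [if_neg (by omega), if_pos (by omega), Nat.add_sub_cancel_left]
      have h3 : ∀ p ∈ Finset.range b, g (lo + (a + (2 + p)))
          = symmTreeCount m (p + 2) (b - 1 - p) := by
        intro p hp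
        have := Finset.mem_range.1 hp
        have e : lo + (a + (2 + p)) - (lo + a + 2) = p := by omega
        rw [hg]
        simp only
        rw [if_neg (by omega), if_neg (by omega), if_neg (by omega), if_neg (by omega),
          if_pos (by omega), e]
      have h4 : ∀ p ∈ Finset.range d, g (lo + (a + (2 + (b + p)))) = 0 := by
        intro p hp
        rw [hg]
        simp only
        rw [if_neg (by omega), if_neg (by omega), if_neg (by omega), if_neg (by omega),
          if_neg (by omega)]
      rw [Finset.sum_eq_zero h1, Finset.sum_congr rfl h2, Finset.sum_congr rfl h3,
        Finset.sum_eq_zero h4]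
      have h5 : g (lo + (a + 0)) = symmTreeCount m a (b + 1) := by simp [hg]
      have h6 : g (lo + (a + 1)) = symmTreeCount m (a + 1) b := by
        rw [hg]
        simp only
        rw [if_neg (by omega), if_neg (by omega), if_neg (by omega), if_pos (by omega)]
      simp only [Finset.sum_range_succ, Finset.sum_range_zero, h5, h6]
      ring
    · intro p hp hpa
      have hpn : (p : ℕ) ≤ n := by omega
      rw [hact p hpn] at hpa
      have act := fun s (hs : s ≤ n + 1) => hact _ (collapseGap_le hpn hs)
      have key : ∀ lo' a' b' : ℕ, lo' + a' = p → lo' + a' + b' + 1 ≤ n + 1 →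
          (∀ s ≤ n + 1, (lo ≤ collapseGap p s ∧ collapseGap p s ≤ lo + a + b + 1) ∧
            ¬ (collapseGap p s < lo + a ∧ lo + a + 2 ≤ p ∨
              p < lo + a ∧ lo + a + 2 ≤ collapseGap p s) ↔
            lo' ≤ s ∧ s ≤ lo' + a' + b' + 1) →
          descendants insertMax (fun π => ¬ HasConfiguration HighLowMidLowHigh π) m
            (insertMax π p) = symmTreeCount m a' b' := by
        intro lo' a' b' hpe hn' hs'
        refine ih _ lo' a' b' hn' hp ?_ ?_
        · intro s hs
          rw [activeGap_insertMax _ hR, act s hs, ← hs' s hs]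
          refine and_congr_right fun h => not_congr ?_
          exact hconf _ _ h.1 h.2 hpa.1 hpa.2
        · intro s t hs1 hs2 ht1 ht2
          have h1 := (hs' s (by omega)).2 ⟨hs1, hs2⟩
          have h2 := (hs' t (by omega)).2 ⟨ht1, ht2⟩
          rw [conflictingGaps_highLowMidLowHigh _ _ (by omega) (by omega),
            hconf _ _ h1.1.1 h1.1.2 h2.1.1 h2.1.2, hpe]
          -- Between surviving gaps, every old conflict is also one caused by the new maximum.
          refine or_iff_right_of_imp fun h => ?_
          unfold collapseGap at h h1 h2
          split_ifs at h h1 h2 <;> omega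
      rw [hg]
      simp only
      rw [if_neg (by omega)]
      split_ifs with h1 h2 h3 h4
      · refine key lo _ _ (by omega) (by omega) fun s hs => ?_
        unfold collapseGap
        split_ifs <;> omega
      · refine key lo _ _ (by omega) (by omega) fun s hs => ?_
        unfold collapseGap
        split_ifs <;> omega
      · refine key lo _ _ (by omega) (by omega) fun s hs => ?_
        unfold collapseGap
        split_ifs <;> omega
      · refine key (lo + a) _ _ (by omega) (by omega) fun s hs => ?_
        unfold collapseGap
        split_ifs <;> omega
      · omega
    · intro p hp hpa
      rw [hact p hp] at hpa
      rw [hg]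
      simp only
      split_ifs <;> first | rfl | omega

theorem ncard_not_highLowMidLowHigh (n : ℕ) :
    ({π : Equiv.Perm (Fin n) | ¬ HasConfiguration HighLowMidLowHigh π}.ncard : ℤ)
      = treeCount n 0 := by
  have hR := isConfiguration_highLowMidLowHigh
  rw [ncard_not_hasConfiguration hR]
  cases n with
  | zero => simp [descendants, treeCount]
  | succ m =>
    rw [descendants_insertMax_succ _ hR (not_hasConfiguration_of_length_zero _) m
      (fun _ => treeCount m 1)]
    · simp [treeCount_succ_zero]
    · intro p hp _
      rw [descendants_highLowMidLowHigh m _ 0 0 0 (by simp) hp]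
      · simp [symmTreeCount]
      · intro s hs
        rw [activeGap_insertMax _ hR]
        simpa [activeGap_of_length_zero, not_conflictingGaps_of_length_zero] using hs
      · intro s t _ hs _ ht
        rw [conflictingGaps_highLowMidLowHigh _ _ hs ht]
        simp [not_conflictingGaps_of_length_zero]
    · exact fun p _ h => absurd (activeGap_of_length_zero _ _) h

/-! ### Inversion sequences -/

/-- The inversion sequences of length `n`, as dependent functions. -/
abbrev InvSeq (n : ℕ) : Type := ∀ i : Fin n, Fin ((i : ℕ) + 1)

/-- The inversion sequence obtained by appending the letter `x`. -/
def InvSeq.append {n : ℕ} (e : InvSeq n) (x : Fin (n + 1)) : InvSeq (n + 1) :=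
  Fin.snoc (α := fun i : Fin (n + 1) => Fin ((i : ℕ) + 1)) e x

namespace InvSeq

variable {n : ℕ} (e : InvSeq n)

@[simp]
theorem append_last (x : Fin (n + 1)) : e.append x (Fin.last n) = x := by
  simp [append]

@[simp]
theorem append_castSucc (x : Fin (n + 1)) (i : Fin n) : e.append x i.castSucc = e i := by
  simp [append]

theorem append_bijective (n : ℕ) :
    Function.Bijective fun y : InvSeq n × Fin (n + 1) => y.1.append y.2 :=
  ((Equiv.prodComm _ _).trans
    (Fin.snocEquiv fun i : Fin (n + 1) => Fin ((i : ℕ) + 1))).bijective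

/-- Some letter of `e` is followed by two distinct smaller letters. -/
def HasTwoBelow : Prop :=
  ∃ i j k, i < j ∧ j < k ∧ (e j : ℕ) < e i ∧ (e k : ℕ) < e i ∧ (e j : ℕ) ≠ e k

/-- The letter `v` can be appended to `e`. -/
def ActiveLetter (v : ℕ) : Prop :=
  ¬ ∃ i j, i < j ∧ (e j : ℕ) < e i ∧ v < e i ∧ (e j : ℕ) ≠ v

theorem hasTwoBelow_append (x : Fin (n + 1)) :
    (e.append x).HasTwoBelow ↔ e.HasTwoBelow ∨ ¬ e.ActiveLetter x := by
  have lt : ∀ i : Fin n, ¬ Fin.last n < i.castSucc := fun x => not_lt_of_ge (Fin.le_last _)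
  simp only [HasTwoBelow, ActiveLetter, Fin.exists_fin_succ', append_last, append_castSucc, lt,
    lt_irrefl, and_false, false_and, exists_false, or_false, not_not,
    Fin.castSucc_lt_castSucc_iff, Fin.castSucc_lt_last, true_and, exists_or]

theorem activeLetter_append (x : Fin (n + 1)) (v : ℕ) :
    (e.append x).ActiveLetter v ↔
      e.ActiveLetter v ∧ ¬ ∃ i, (x : ℕ) < e i ∧ v < e i ∧ (x : ℕ) ≠ v := by
  have lt : ∀ i : Fin n, ¬ Fin.last n < i.castSucc := fun x => not_lt_of_ge (Fin.le_last _)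
  simp only [ActiveLetter, Fin.exists_fin_succ', append_last, append_castSucc, lt,
    lt_irrefl, and_false, false_and, exists_false, or_false,
    Fin.castSucc_lt_castSucc_iff, Fin.castSucc_lt_last, true_and, exists_or, not_or]

theorem exists_lt_append (x : Fin (n + 1)) (v : ℕ) :
    (∃ i, v < (e.append x i : ℕ)) ↔ (∃ i, v < (e i : ℕ)) ∨ v < x := by
  simp only [Fin.exists_fin_succ', append_last, append_castSucc]

/-- The letters that can be appended are the elements of `S`, all smaller than the maximum `M`,
and the letters from `M` on. -/
theorem descendants_append (m : ℕ) {n : ℕ} (e : InvSeq n) (S : Finset ℕ) (M h k : ℕ)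
    (hn : n = M + h) (hcard : S.card = k) (hS : ∀ v ∈ S, v < M)
    (hmax : ∀ v, (∃ i, v < (e i : ℕ)) ↔ v < M) (he : ¬ e.HasTwoBelow)
    (hact : ∀ v, e.ActiveLetter v ↔ v ∈ S ∨ M ≤ v) :
    descendants InvSeq.append (fun e => ¬ e.HasTwoBelow) m e = treeCount₂ m h k := by
  induction m generalizing n S M h k with
  | zero => simp [descendants, treeCount₂_zero]
  | succ m ih =>
    have hmax' : ∀ x v : ℕ, (∃ i, x < (e i : ℕ) ∧ v < e i ∧ x ≠ v) ↔ x < M ∧ v < M ∧ x ≠ v := by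
      intro x v
      -- Two values lie below a common entry exactly when their maximum lies below some entry.
      have := hmax (max x v)
      simp only [max_lt_iff] at this
      rw [← and_assoc, ← this]
      simp only [← and_assoc, exists_and_right]
    have hstep : descendants InvSeq.append (fun e => ¬ e.HasTwoBelow) (m + 1) e
        = ∑ p ∈ Finset.range (n + 1), if M ≤ p then treeCount₂ m (h + 1 - (p - M)) (k + (p - M))
          else if p ∈ S then treeCount m (h + 2) else 0 := by
      rw [descendants, ← Fin.sum_univ_eq_sum_range
        (fun p => if M ≤ p then treeCount₂ m (h + 1 - (p - M)) (k + (p - M))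
          else if p ∈ S then treeCount m (h + 2) else 0)]
      refine Finset.sum_congr rfl fun x _ => ?_
      have hx := hasTwoBelow_append e x
      rw [hact] at hx
      by_cases h1 : M ≤ x
      · have hgood : ¬ (e.append x).HasTwoBelow := by tauto
        rw [if_pos hgood, if_pos h1]
        -- A letter `x ≥ M` is the new maximum; the values from `M` to `x - 1` stay available but
        -- now lie below it.
        refine ih _ (S ∪ Finset.Ico M x) x _ _ (by omega) ?_ ?_ ?_ hgood ?_
        · rw [Finset.card_union_of_disjoint, hcard, Nat.card_Ico]
          refine Finset.disjoint_left.2 fun v hv hv' => ?_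
          have := hS v hv
          rw [Finset.mem_Ico] at hv'
          omega
        · intro v hv
          rcases Finset.mem_union.1 hv with hv | hv
          · exact (hS v hv).trans_le h1
          · exact (Finset.mem_Ico.1 hv).2
        · intro v
          rw [exists_lt_append, hmax]
          omega
        · intro v
          rw [activeLetter_append, hact, hmax', Finset.mem_union, Finset.mem_Ico]
          have := hS v
          constructor
          · rintro ⟨hv | hv, -⟩
            · exact .inl (.inl hv)
            · omega
          · rintro ((hv | hv) | hv)
            · exact ⟨.inl hv, by omega⟩
            · exact ⟨.inr hv.1, by omega⟩
            · exact ⟨.inr (by omega), by omega⟩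
      · rw [if_neg h1]
        by_cases h2 : (x : ℕ) ∈ S
        · have hgood : ¬ (e.append x).HasTwoBelow := by tauto
          rw [if_pos hgood, if_pos h2, ← treeCount₂_one_right]
          -- Once `x < M` follows the maximum, the only value below `M` still allowed is `x` itself.
          refine ih _ {(x : ℕ)} M _ _ (by omega) (by simp) (by simpa using h1) ?_ hgood ?_
          · intro v
            rw [exists_lt_append, hmax]
            omega
          · intro v
            rw [activeLetter_append, hact, hmax', Finset.mem_singleton]
            constructor
            · rintro ⟨-, hv⟩
              omega
            · rintro (rfl | hv)
              · exact ⟨.inl h2, by omega⟩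
              · exact ⟨.inr hv, by omega⟩
        · rw [if_neg h2, if_neg (by tauto)]
    have e1 : n + 1 = M + (h + 1) := by omega
    rw [hstep, e1, Finset.sum_range_add, treeCount₂_succ, add_comm]
    congr 1
    · rw [← Finset.sum_range_reflect]
      refine Finset.sum_congr rfl fun i hi => ?_
      have := Finset.mem_range.1 hi
      rw [if_pos (by omega)]
      congr 1 <;> omega
    · have h1 : ∀ p ∈ Finset.range M, (if M ≤ p then treeCount₂ m (h + 1 - (p - M)) (k + (p - M))
          else if p ∈ S then treeCount m (h + 2) else 0)
          = if p ∈ S then treeCount m (h + 2) else 0 := by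
        intro p hp
        rw [if_neg (by simpa using hp)]
      have h2 : Finset.range M ∩ S = S :=
        Finset.inter_eq_right.2 fun v hv => Finset.mem_range.2 (hS v hv)
      rw [Finset.sum_congr rfl h1, Finset.sum_ite_mem, h2]
      simp [hcard]

theorem ncard_not_hasTwoBelow (n : ℕ) :
    ({e : InvSeq n | ¬ e.HasTwoBelow}.ncard : ℤ) = treeCount n 0 := by
  have h0 : ∀ e : InvSeq 0, ¬ e.HasTwoBelow := fun _ ⟨i, _⟩ => i.elim0
  rw [ncard_good_eq_descendants (X := InvSeq) InvSeq.append (fun e => ¬ e.HasTwoBelow)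
    append_bijective (fun e x h h' => h ((hasTwoBelow_append e x).2 (.inl h'))) (h0 _),
    descendants_append n _ ∅ 0 0 0 rfl rfl (by simp) ?_ (h0 _) ?_, treeCount₂_zero_right]
  · intro v
    simp
  · intro v
    simp [ActiveLetter]

end InvSeq

theorem containsPattern_three {n : ℕ} (w : Fin n → ℕ) (p : Fin 3 → ℕ) :
    ContainsPattern w p ↔ ∃ a b c : Fin n, a < b ∧ b < c ∧
      ∀ i j, w (![a, b, c] i) < w (![a, b, c] j) ↔ p i < p j := by
  constructor
  · rintro ⟨f, hf, h⟩
    have e : f = ![f 0, f 1, f 2] := by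
      ext i
      fin_cases i <;> rfl
    refine ⟨f 0, f 1, f 2, hf (by decide), hf (by decide), ?_⟩
    rwa [← e]
  · rintro ⟨a, b, c, hab, hbc, h⟩
    refine ⟨_, Fin.strictMono_iff_lt_succ.2 ?_, h⟩
    simp [Fin.forall_fin_succ, hab, hbc]

theorem avoidsPatterns_iff_not_hasTwoBelow {n : ℕ} (e : InvSeq n) :
    AvoidsPatterns (fun i => (e i : ℕ)) {![2, 0, 1], ![2, 1, 0]} ↔ ¬ e.HasTwoBelow := by
  simp only [AvoidsPatterns, Set.mem_insert_iff, Set.mem_singleton_iff, forall_eq_or_imp,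
    forall_eq, ← not_or, containsPattern_three]
  refine not_congr ⟨?_, ?_⟩
  · rintro (⟨a, b, c, hab, hbc, h⟩ | ⟨a, b, c, hab, hbc, h⟩)
    · have h1 := (h 1 0).2 (by simp)
      have h2 := (h 2 0).2 (by simp)
      have h3 := (h 1 2).2 (by simp)
      exact ⟨a, b, c, hab, hbc, h1, h2, h3.ne⟩
    · have h1 := (h 1 0).2 (by simp)
      have h2 := (h 2 0).2 (by simp)
      have h3 := (h 2 1).2 (by simp)
      exact ⟨a, b, c, hab, hbc, h1, h2, h3.ne'⟩
  · rintro ⟨a, b, c, hab, hbc, h1, h2, h3⟩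
    rcases lt_or_gt_of_ne h3 with h3 | h3
    · refine .inl ⟨a, b, c, hab, hbc, ?_⟩
      simp [Fin.forall_fin_succ, -Fin.val_fin_lt]
      omega
    · refine .inr ⟨a, b, c, hab, hbc, ?_⟩
      simp [Fin.forall_fin_succ, -Fin.val_fin_lt]
      omega

theorem ncard_inversionSequencesAvoiding (n : ℕ) :
    ((inversionSequencesAvoiding n {![2, 0, 1], ![2, 1, 0]}).ncard : ℤ) = treeCount n 0 := by
  rw [← InvSeq.ncard_not_hasTwoBelow]
  have hinj : Function.Injective fun (e : InvSeq n) (i : Fin n) => (e i : ℕ) := by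
    intro e e' h
    ext i
    exact congrFun h i
  rw [← Set.ncard_image_of_injective _ hinj]
  congr 2
  ext w
  constructor
  · rintro ⟨hw, ha⟩
    exact ⟨fun i => ⟨w i, hw i⟩, (avoidsPatterns_iff_not_hasTwoBelow _).1 ha, rfl⟩
  · rintro ⟨e, he, rfl⟩
    exact ⟨fun i => (e i).2, (avoidsPatterns_iff_not_hasTwoBelow e).2 he⟩

/-! ### Permutation patterns of length five -/

theorem strictMono_five {n : ℕ} {a b c d e : Fin n} (hab : a < b) (hbc : b < c) (hcd : c < d)
    (hde : d < e) : StrictMono ![a, b, c, d, e] := by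
  refine Fin.strictMono_iff_lt_succ.2 ?_
  simp [Fin.forall_fin_succ, hab, hbc, hcd, hde]

/-- Avoidance of a set `P` of patterns of length five that consists of all patterns in which the
letters at places `j` and `k` are smaller, and those at places `l` and `m` are larger, than the
letter at place `i`. -/
theorem avoidsPatterns_iff_places {n : ℕ} (π : Equiv.Perm (Fin n)) {P : Set (Fin 5 → ℕ)}
    (i j k l m : Fin 5) (hjk : j ≠ k) (hlm : l ≠ m)
    (hP : ∀ p ∈ P, p j < p i ∧ p k < p i ∧ p i < p l ∧ p i < p m)
    (hP' : ∀ w : Fin 5 → ℕ, w j < w i → w k < w i → w i < w l → w i < w m → w j ≠ w k →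
      w l ≠ w m → ∃ p ∈ P, ∀ a b, w a < w b ↔ p a < p b) :
    AvoidsPatterns (permWord π) P ↔ ¬ ∃ f : Fin 5 → Fin n, StrictMono f ∧
      π (f j) < π (f i) ∧ π (f k) < π (f i) ∧ π (f i) < π (f l) ∧ π (f i) < π (f m) := by
  have hlt : ∀ a b, permWord π a < permWord π b ↔ π a < π b := by
    simp [permWord]
  have hinj : Function.Injective (permWord π) := by
    intro a b h
    have h' : (π a : ℕ) + 1 = π b + 1 := h
    exact π.injective (Fin.ext (by omega))
  constructor
  · rintro h ⟨f, hf, h1, h2, h3, h4⟩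
    simp only [← hlt] at h1 h2 h3 h4
    obtain ⟨p, hp, hfp⟩ := hP' (fun a => permWord π (f a)) h1 h2 h3 h4
      (hinj.ne (hf.injective.ne hjk)) (hinj.ne (hf.injective.ne hlm))
    exact h p hp ⟨f, hf, hfp⟩
  · rintro h p hp ⟨f, hf, hfp⟩
    obtain ⟨h1, h2, h3, h4⟩ := hP p hp
    refine h ⟨f, hf, ?_⟩
    simp only [← hlt, hfp]
    exact ⟨h1, h2, h3, h4⟩

theorem avoidsPatterns_iff_not_highHighMidLowLow {n : ℕ} (π : Equiv.Perm (Fin n)) :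
    AvoidsPatterns (permWord π)
      {![4, 5, 3, 1, 2], ![4, 5, 3, 2, 1], ![5, 4, 3, 1, 2], ![5, 4, 3, 2, 1]} ↔
      ¬ HasConfiguration HighHighMidLowLow π := by
  rw [avoidsPatterns_iff_places π 2 3 4 0 1 (by decide) (by decide)]
  · refine not_congr ⟨?_, ?_⟩
    · rintro ⟨f, hf, h⟩
      have h01 : f 0 < f 1 := hf (by decide)
      have h12 : f 1 < f 2 := hf (by decide)
      have h23 : f 2 < f 3 := hf (by decide)
      have h34 : f 3 < f 4 := hf (by decide)
      refine ⟨f 2, f 3, f 4, f 0, f 1, by omega, ?_, h⟩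
      unfold HighHighMidLowLow
      omega
    · rintro ⟨i, j, k, l, m, hlm, hR, h⟩
      -- The relation, phrased for gaps, allows weak inequalities; comparing values makes them
      -- strict for letters.
      have hli : l ≠ i := fun e => lt_irrefl _ (e ▸ h.2.2.1)
      have hmi : m ≠ i := fun e => lt_irrefl _ (e ▸ h.2.2.2)
      have hlj : l ≠ j := fun e => lt_asymm h.1 (e ▸ h.2.2.1)
      have hmj : m ≠ j := fun e => lt_asymm h.1 (e ▸ h.2.2.2)
      have hlk : l ≠ k := fun e => lt_asymm h.2.1 (e ▸ h.2.2.1)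
      have hmk : m ≠ k := fun e => lt_asymm h.2.1 (e ▸ h.2.2.2)
      unfold HighHighMidLowLow at hR
      rcases lt_or_gt_of_ne hlm with hlt | hlt
      · exact ⟨![l, m, i, j, k], strictMono_five (by omega) (by omega) (by omega) (by omega), h⟩
      · exact ⟨![m, l, i, j, k], strictMono_five (by omega) (by omega) (by omega) (by omega),
          h.1, h.2.1, h.2.2.2, h.2.2.1⟩
  · simp
  · intro w h1 h2 h3 h4 h5 h6
    -- The orders of the two small and of the two large letters select one of the four patterns.
    rcases lt_or_gt_of_ne h5 with h5 | h5 <;> rcases lt_or_gt_of_ne h6 with h6 | h6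
    · refine ⟨![4, 5, 3, 1, 2], by simp, ?_⟩
      simp [Fin.forall_fin_succ]
      omega
    · refine ⟨![5, 4, 3, 1, 2], by simp, ?_⟩
      simp [Fin.forall_fin_succ]
      omega
    · refine ⟨![4, 5, 3, 2, 1], by simp, ?_⟩
      simp [Fin.forall_fin_succ]
      omega
    · refine ⟨![5, 4, 3, 2, 1], by simp, ?_⟩
      simp [Fin.forall_fin_succ]
      omega

theorem avoidsPatterns_iff_not_midLowLowHighHigh {n : ℕ} (π : Equiv.Perm (Fin n)) :
    AvoidsPatterns (permWord π)
      {![3, 1, 2, 4, 5], ![3, 2, 1, 4, 5], ![3, 1, 2, 5, 4], ![3, 2, 1, 5, 4]} ↔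
      ¬ HasConfiguration MidLowLowHighHigh π := by
  rw [avoidsPatterns_iff_places π 0 1 2 3 4 (by decide) (by decide)]
  · refine not_congr ⟨?_, ?_⟩
    · rintro ⟨f, hf, h⟩
      have h01 : f 0 < f 1 := hf (by decide)
      have h12 : f 1 < f 2 := hf (by decide)
      have h23 : f 2 < f 3 := hf (by decide)
      have h34 : f 3 < f 4 := hf (by decide)
      refine ⟨f 0, f 1, f 2, f 3, f 4, by omega, ?_, h⟩
      unfold MidLowLowHighHigh
      omega
    · rintro ⟨i, j, k, l, m, hlm, hR, h⟩
      have hli : l ≠ i := fun e => lt_irrefl _ (e ▸ h.2.2.1)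
      have hmi : m ≠ i := fun e => lt_irrefl _ (e ▸ h.2.2.2)
      have hlj : l ≠ j := fun e => lt_asymm h.1 (e ▸ h.2.2.1)
      have hmj : m ≠ j := fun e => lt_asymm h.1 (e ▸ h.2.2.2)
      have hlk : l ≠ k := fun e => lt_asymm h.2.1 (e ▸ h.2.2.1)
      have hmk : m ≠ k := fun e => lt_asymm h.2.1 (e ▸ h.2.2.2)
      unfold MidLowLowHighHigh at hR
      rcases lt_or_gt_of_ne hlm with hlt | hlt
      · exact ⟨![i, j, k, l, m], strictMono_five (by omega) (by omega) (by omega) (by omega), h⟩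
      · exact ⟨![i, j, k, m, l], strictMono_five (by omega) (by omega) (by omega) (by omega),
          h.1, h.2.1, h.2.2.2, h.2.2.1⟩
  · simp
  · intro w h1 h2 h3 h4 h5 h6
    rcases lt_or_gt_of_ne h5 with h5 | h5 <;> rcases lt_or_gt_of_ne h6 with h6 | h6
    · refine ⟨![3, 1, 2, 4, 5], by simp, ?_⟩
      simp [Fin.forall_fin_succ]
      omega
    · refine ⟨![3, 1, 2, 5, 4], by simp, ?_⟩
      simp [Fin.forall_fin_succ]
      omega
    · refine ⟨![3, 2, 1, 4, 5], by simp, ?_⟩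
      simp [Fin.forall_fin_succ]
      omega
    · refine ⟨![3, 2, 1, 5, 4], by simp, ?_⟩
      simp [Fin.forall_fin_succ]
      omega

theorem avoidsPatterns_iff_not_midLowHighLowHigh {n : ℕ} (π : Equiv.Perm (Fin n)) :
    AvoidsPatterns (permWord π)
      {![3, 1, 4, 2, 5], ![3, 2, 4, 1, 5], ![3, 1, 5, 2, 4], ![3, 2, 5, 1, 4]} ↔
      ¬ HasConfiguration MidLowHighLowHigh π := by
  rw [avoidsPatterns_iff_places π 0 1 3 2 4 (by decide) (by decide)]
  · refine not_congr ⟨?_, ?_⟩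
    · rintro ⟨f, hf, h⟩
      have h01 : f 0 < f 1 := hf (by decide)
      have h12 : f 1 < f 2 := hf (by decide)
      have h23 : f 2 < f 3 := hf (by decide)
      have h34 : f 3 < f 4 := hf (by decide)
      refine ⟨f 0, f 1, f 3, f 2, f 4, by omega, ?_, h⟩
      unfold MidLowHighLowHigh
      omega
    · rintro ⟨i, j, k, l, m, hlm, hR, h⟩
      have hli : l ≠ i := fun e => lt_irrefl _ (e ▸ h.2.2.1)
      have hmi : m ≠ i := fun e => lt_irrefl _ (e ▸ h.2.2.2)
      have hlj : l ≠ j := fun e => lt_asymm h.1 (e ▸ h.2.2.1)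
      have hmj : m ≠ j := fun e => lt_asymm h.1 (e ▸ h.2.2.2)
      have hlk : l ≠ k := fun e => lt_asymm h.2.1 (e ▸ h.2.2.1)
      have hmk : m ≠ k := fun e => lt_asymm h.2.1 (e ▸ h.2.2.2)
      unfold MidLowHighLowHigh at hR
      rcases lt_or_gt_of_ne hlm with hlt | hlt
      · exact ⟨![i, j, l, k, m], strictMono_five (by omega) (by omega) (by omega) (by omega), h⟩
      · exact ⟨![i, j, m, k, l], strictMono_five (by omega) (by omega) (by omega) (by omega),
          h.1, h.2.1, h.2.2.2, h.2.2.1⟩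
  · simp
  · intro w h1 h2 h3 h4 h5 h6
    rcases lt_or_gt_of_ne h5 with h5 | h5 <;> rcases lt_or_gt_of_ne h6 with h6 | h6
    · refine ⟨![3, 1, 4, 2, 5], by simp, ?_⟩
      simp [Fin.forall_fin_succ]
      omega
    · refine ⟨![3, 1, 5, 2, 4], by simp, ?_⟩
      simp [Fin.forall_fin_succ]
      omega
    · refine ⟨![3, 2, 4, 1, 5], by simp, ?_⟩
      simp [Fin.forall_fin_succ]
      omega
    · refine ⟨![3, 2, 5, 1, 4], by simp, ?_⟩
      simp [Fin.forall_fin_succ]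
      omega

theorem avoidsPatterns_iff_not_highLowMidLowHigh {n : ℕ} (π : Equiv.Perm (Fin n)) :
    AvoidsPatterns (permWord π)
      {![4, 1, 3, 2, 5], ![5, 1, 3, 2, 4], ![4, 2, 3, 1, 5], ![5, 2, 3, 1, 4]} ↔
      ¬ HasConfiguration HighLowMidLowHigh π := by
  rw [avoidsPatterns_iff_places π 2 1 3 0 4 (by decide) (by decide)]
  · refine not_congr ⟨?_, ?_⟩
    · rintro ⟨f, hf, h⟩
      have h01 : f 0 < f 1 := hf (by decide)
      have h12 : f 1 < f 2 := hf (by decide)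
      have h23 : f 2 < f 3 := hf (by decide)
      have h34 : f 3 < f 4 := hf (by decide)
      refine ⟨f 2, f 1, f 3, f 0, f 4, by omega, ?_, h⟩
      unfold HighLowMidLowHigh
      omega
    · rintro ⟨i, j, k, l, m, hlm, hR, h⟩
      have hli : l ≠ i := fun e => lt_irrefl _ (e ▸ h.2.2.1)
      have hmi : m ≠ i := fun e => lt_irrefl _ (e ▸ h.2.2.2)
      have hlj : l ≠ j := fun e => lt_asymm h.1 (e ▸ h.2.2.1)
      have hmj : m ≠ j := fun e => lt_asymm h.1 (e ▸ h.2.2.2)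
      have hlk : l ≠ k := fun e => lt_asymm h.2.1 (e ▸ h.2.2.1)
      have hmk : m ≠ k := fun e => lt_asymm h.2.1 (e ▸ h.2.2.2)
      unfold HighLowMidLowHigh at hR
      rcases lt_or_gt_of_ne hlm with hlt | hlt
      · exact ⟨![l, j, i, k, m], strictMono_five (by omega) (by omega) (by omega) (by omega), h⟩
      · exact ⟨![m, j, i, k, l], strictMono_five (by omega) (by omega) (by omega) (by omega),
          h.1, h.2.1, h.2.2.2, h.2.2.1⟩
  · simp
  · intro w h1 h2 h3 h4 h5 h6
    rcases lt_or_gt_of_ne h5 with h5 | h5 <;> rcases lt_or_gt_of_ne h6 with h6 | h6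
    · refine ⟨![4, 1, 3, 2, 5], by simp, ?_⟩
      simp [Fin.forall_fin_succ]
      omega
    · refine ⟨![5, 1, 3, 2, 4], by simp, ?_⟩
      simp [Fin.forall_fin_succ]
      omega
    · refine ⟨![4, 2, 3, 1, 5], by simp, ?_⟩
      simp [Fin.forall_fin_succ]
      omega
    · refine ⟨![5, 2, 3, 1, 4], by simp, ?_⟩
      simp [Fin.forall_fin_succ]
      omega

/-! ### Marked mesh patterns -/

theorem two_le_ncard_iff {α : Type*} [Finite α] (s : Set α) :
    2 ≤ s.ncard ↔ ∃ a ∈ s, ∃ b ∈ s, a ≠ b :=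
  Set.one_lt_ncard (Set.toFinite s)

theorem forall_not_matchesMMP_iff {n : ℕ} (π : Equiv.Perm (Fin n)) :
    (∀ i, ¬ MatchesMMP 0 2 0 2 π i) ↔ ¬ HasConfiguration HighHighMidLowLow π := by
  rw [← not_exists]
  refine not_congr ⟨?_, ?_⟩
  · rintro ⟨i, -, hl, -, hr⟩
    obtain ⟨l, hl, m, hm, hlm⟩ := (two_le_ncard_iff _).1 hl
    obtain ⟨j, hj, k, hk, hjk⟩ := (two_le_ncard_iff _).1 hr
    simp only [Set.mem_ofPred_eq] at hl hm hj hk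
    -- The configuration orders the two smaller letters but not the two larger ones.
    rcases lt_or_gt_of_ne hjk with h | h
    · exact ⟨i, j, k, l, m, hlm, ⟨hl.1.le, hm.1.le, hj.1, h⟩, hj.2, hk.2, hl.2, hm.2⟩
    · exact ⟨i, k, j, l, m, hlm, ⟨hl.1.le, hm.1.le, hk.1, h⟩, hk.2, hj.2, hl.2, hm.2⟩
  · rintro ⟨i, j, k, l, m, hlm, ⟨hli, hmi, hij, hjk⟩, h⟩
    have hli' : l ≠ i := fun e => lt_irrefl _ (e ▸ h.2.2.1)
    have hmi' : m ≠ i := fun e => lt_irrefl _ (e ▸ h.2.2.2)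
    refine ⟨i, Nat.zero_le _, (two_le_ncard_iff _).2 ?_, Nat.zero_le _,
      (two_le_ncard_iff _).2 ?_⟩
    · exact ⟨l, ⟨by omega, h.2.2.1⟩, m, ⟨by omega, h.2.2.2⟩, hlm⟩
    · exact ⟨j, ⟨hij, h.1⟩, k, ⟨hij.trans hjk, h.2.1⟩, by omega⟩

theorem A212198_eq_treeCount (n : ℕ) : (A212198 n : ℤ) = treeCount n 0 := by
  simp only [A212198, forall_not_matchesMMP_iff, ncard_not_highHighMidLowLow]

theorem corollary4p8 (n : ℕ) :
    (permAvoiding n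
      {![4, 5, 3, 1, 2], ![4, 5, 3, 2, 1], ![5, 4, 3, 1, 2], ![5, 4, 3, 2, 1]}).ncard
        = A212198 n ∧
    (permAvoiding n
      {![3, 1, 2, 4, 5], ![3, 2, 1, 4, 5], ![3, 1, 2, 5, 4], ![3, 2, 1, 5, 4]}).ncard
        = A212198 n ∧
    (permAvoiding n
      {![3, 1, 4, 2, 5], ![3, 2, 4, 1, 5], ![3, 1, 5, 2, 4], ![3, 2, 5, 1, 4]}).ncard
        = A212198 n ∧
    (inversionSequencesAvoiding n {![2, 0, 1], ![2, 1, 0]}).ncard = A212198 n ∧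
    (permAvoiding n
      {![4, 1, 3, 2, 5], ![5, 1, 3, 2, 4], ![4, 2, 3, 1, 5], ![5, 2, 3, 1, 4]}).ncard
        = A212198 n := by
  simp only [← Nat.cast_inj (R := ℤ), A212198_eq_treeCount, permAvoiding,
    avoidsPatterns_iff_not_highHighMidLowLow, avoidsPatterns_iff_not_midLowLowHighHigh,
    avoidsPatterns_iff_not_midLowHighLowHigh, avoidsPatterns_iff_not_highLowMidLowHigh]
  exact ⟨ncard_not_highHighMidLowLow n, ncard_not_midLowLowHighHigh n,
    ncard_not_midLowHighLowHigh n, ncard_inversionSequencesAvoiding n,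
    ncard_not_highLowMidLowHigh n⟩
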